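/- Let $G$ be a (real, finite-dimensional) Lie group with Lie algebra $\mathfrak g$, let $K\subset G$ be a closed subgroup with Lie algebra $\mathfrak k$, and let $G/K$ carry its smooth structure for which the projection $\pi:G\to G/K$ is a smooth submersion. Suppose that $\mathfrak g=\mathfrak k\oplus\mathfrak m$ is a reductive decomposition, i.e. $\mathfrak m$ is a linear complement of $\mathfrak k$ with $[\mathfrak k,\mathfrak m]\subset\mathfrak m$, and let $g$ be a $G$-invariant Riemannian metric on $G/K$ with Levi-Civita connection $\nabla$. Let $I\subset\mathbb R$ be an interval with more than one point, let $\alpha:I\to G$ be a smooth curve and let $\gamma=\pi\circ\alpha:I\to G/K$. For $W\in\mathfrak m$ let $W^L$ be the left-invariant vector field on $G$ with $W^L_e=W$, put $\hat W_{\gamma(t)}=d\pi_{\alpha(t)}\big(W^L_{\alpha(t)}\big)\in T_{\gamma(t)}(G/K)$, and let $$G_W(t)=g\big(\hat W_{\gamma(t)},\nabla_{\dot\gamma(t)}\dot\gamma(t)\big)_{\gamma(t)},\qquad t\in I,$$ where $\nabla_{\dot\gamma}\dot\gamma$ is the covariant derivative of $\dot\gamma$ along $\gamma$. Then $\gamma$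 is a geodesic of $(G/K,g)$, i.e. $\nabla_{\dot\gamma(t)}\dot\gamma(t)=0$ for all $t\in I$, if and only if $G_W(t)=0$ for all $t\in I$ and all $W\in\mathfrak m$. -/

import Mathlib

open scoped Manifold ContDiff Topology Bundle

noncomputable section

namespace HomogeneousGeodesics

section Curves

variable {F : Type*} [NormedAddCommGroup F] [NormedSpace ℝ F]
  {M : Type*} [TopologicalSpace M] [ChartedSpace F M]

/-- The velocity `γ'(t) ∈ T_{γ(t)} M` of a curve `γ` defined on the interval `J ⊆ ℝ` (one-sided at
an end point that belongs to `J`). -/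
def velocity (J : Set ℝ) (γ : ℝ → M) (t : ℝ) : TangentSpace 𝓘(ℝ, F) (γ t) :=
  mfderivWithin 𝓘(ℝ, ℝ) 𝓘(ℝ, F) γ J t (1 : ℝ)

end Curves

section LeviCivita

variable {F : Type*} [NormedAddCommGroup F] [NormedSpace ℝ F]
  {M : Type*} [TopologicalSpace M] [ChartedSpace F M] [IsManifold 𝓘(ℝ, F) ∞ M]

/-- The type of smooth Riemannian metrics on the manifold `M`. -/
abbrev Metric (F : Type*) [NormedAddCommGroup F] [NormedSpace ℝ F]
    (M : Type*) [TopologicalSpace M] [ChartedSpace F M] [IsManifold 𝓘(ℝ, F) ∞ M] :=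
  Bundle.ContMDiffRiemannianMetric 𝓘(ℝ, F) ∞ F (fun x : M => TangentSpace 𝓘(ℝ, F) x)

/-- The differential at `y` of the inverse of the preferred chart at `x₀`: it sends a constant
vector `v ∈ F` to the value at the point with coordinates `y` of the corresponding coordinate
vector field. -/
def coordVec (x₀ : M) (y : F) : F →L[ℝ] TangentSpace 𝓘(ℝ, F) ((extChartAt 𝓘(ℝ, F) x₀).symm y) :=
  mfderiv 𝓘(ℝ, F) 𝓘(ℝ, F) (extChartAt 𝓘(ℝ, F) x₀).symm y

/-- The differential at `x` of the preferred chart at `x₀`: coordinates of tangent vectors. -/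
def vecCoord (x₀ x : M) : TangentSpace 𝓘(ℝ, F) x →L[ℝ] F :=
  mfderiv 𝓘(ℝ, F) 𝓘(ℝ, F) (extChartAt 𝓘(ℝ, F) x₀) x

/-- The metric `g` in the coordinates of the preferred chart at `x₀`, i.e. the functions
`g_{ij}(y)`, as one function with values in the bilinear forms on `F`. -/
def metricCoord (g : Metric F M) (x₀ : M) (y : F) : F →L[ℝ] F →L[ℝ] ℝ :=
  ContinuousLinearMap.bilinearComp (E := F) (F := F)
    (g.inner ((extChartAt 𝓘(ℝ, F) x₀).symm y)) (coordVec x₀ y) (coordVec x₀ y)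

/-- Christoffel symbols of the first kind (the Koszul formula for coordinate vector fields):
`z ↦ ½ (∂_v g(w, z) + ∂_w g(v, z) - ∂_z g(v, w))`. -/
def christoffelLower (g : Metric F M) (x₀ : M) (y v w : F) : F →L[ℝ] ℝ :=
  (1 / 2 : ℝ) • (fderiv ℝ (metricCoord g x₀) y v w + fderiv ℝ (metricCoord g x₀) y w v
    - ((fderiv ℝ (metricCoord g x₀) y).flip v).flip w)

/-- Christoffel symbols `Γ(v, w) = v^i w^j Γ_{ij}^k ∂_k` of the Levi-Civita connection of `g` in the
preferred chart at `x₀`: the index of the symbols of the first kind is raised with the metric. -/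
def christoffel (g : Metric F M) (x₀ : M) (y v w : F) : F :=
  (metricCoord g x₀ y).inverse (christoffelLower g x₀ y v w)

/-- In finite dimensions the metric coefficients are invertible at every point of the chart, so that
`christoffel` is given by the Koszul formula there. -/
theorem metricCoord_isInvertible [FiniteDimensional ℝ F] (g : Metric F M) (x₀ : M) (y : F)
    (hy : y ∈ (extChartAt 𝓘(ℝ, F) x₀).target) : (metricCoord g x₀ y).IsInvertible := by
  have h0 : Function.Injective (coordVec (F := F) x₀ y) := by
    have := isInvertible_mfderivWithin_extChartAt_symm (I := 𝓘(ℝ, F)) hy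
    simp only [modelWithCornersSelf_coe, Set.range_id, mfderivWithin_univ] at this
    obtain ⟨e, he⟩ := this
    unfold coordVec
    rw [← he]
    exact e.injective
  have h1 : Function.Injective (metricCoord g x₀ y) := by
    rw [injective_iff_map_eq_zero]
    intro v hv
    by_contra hne
    have h2 : coordVec x₀ y v ≠ 0 := fun h => hne (h0 (h.trans (map_zero _).symm))
    have h4 : metricCoord g x₀ y v v = 0 := by rw [hv]; rfl
    exact (g.pos _ _ h2).ne' h4
  have h2 : Function.Injective (metricCoord g x₀ y : F →ₗ[ℝ] F →L[ℝ] ℝ) := h1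
  have hd : Module.finrank ℝ F = Module.finrank ℝ (F →L[ℝ] ℝ) :=
    (Subspace.dual_finrank_eq (K := ℝ) (V := F)).symm.trans
      (LinearMap.toContinuousLinearMap (𝕜 := ℝ) (E := F) (F' := ℝ)).finrank_eq
  refine ⟨(LinearEquiv.ofInjectiveOfFinrankEq _ h2 hd).toContinuousLinearEquiv, ?_⟩
  refine ContinuousLinearMap.ext fun x => ?_
  exact congrArg (fun L : F →ₗ[ℝ] F →L[ℝ] ℝ => L x)
    (LinearEquiv.coe_ofInjectiveOfFinrankEq _ h2 hd)

/-- The Koszul formula for the Christoffel symbols. -/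
theorem metricCoord_christoffel [FiniteDimensional ℝ F] (g : Metric F M) (x₀ : M) (y : F)
    (hy : y ∈ (extChartAt 𝓘(ℝ, F) x₀).target) (v w z : F) :
    metricCoord g x₀ y (christoffel g x₀ y v w) z =
      (1 / 2 : ℝ) * (fderiv ℝ (metricCoord g x₀) y v w z + fderiv ℝ (metricCoord g x₀) y w v z
        - fderiv ℝ (metricCoord g x₀) y z v w) := by
  have h := congrArg (fun L => L (christoffelLower g x₀ y v w) z)
    (metricCoord_isInvertible g x₀ y hy).self_comp_inverse
  simpa [christoffel, christoffelLower] using h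

/-- The covariant derivative `∇_{γ'} V` at time `t`, for the Levi-Civita connection of `g`, of a
vector field `V` along the curve `γ` defined on the interval `J`. In the chart at `γ(t)` it is given
by `dV^k/dt + Γ_{ij}^k (γ^i)' V^j`. -/
def covDerivAlong (g : Metric F M) (J : Set ℝ) (γ : ℝ → M)
    (V : (s : ℝ) → TangentSpace 𝓘(ℝ, F) (γ s)) (t : ℝ) : TangentSpace 𝓘(ℝ, F) (γ t) :=
  coordVec (γ t) (extChartAt 𝓘(ℝ, F) (γ t) (γ t))
    (derivWithin (fun s => vecCoord (γ t) (γ s) (V s)) J t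
      + christoffel g (γ t) (extChartAt 𝓘(ℝ, F) (γ t) (γ t))
          (vecCoord (γ t) (γ t) (velocity J γ t)) (vecCoord (γ t) (γ t) (V t)))

/-- The covariant acceleration `∇_{γ'(t)} γ'(t)`. -/
def acceleration (g : Metric F M) (J : Set ℝ) (γ : ℝ → M) (t : ℝ) : TangentSpace 𝓘(ℝ, F) (γ t) :=
  covDerivAlong g J γ (velocity J γ) t

/-- A curve defined on the interval `J` is a geodesic of `g` if it is smooth and its covariant
acceleration vanishes on `J`. -/
def IsGeodesicOn (g : Metric F M) (J : Set ℝ) (γ : ℝ → M) : Prop :=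
  ContMDiffOn 𝓘(ℝ, ℝ) 𝓘(ℝ, F) ∞ γ J ∧ ∀ t ∈ J, acceleration g J γ t = 0

end LeviCivita

section Homogeneous

variable {E : Type*} [NormedAddCommGroup E] [NormedSpace ℝ E]
  {G : Type*} [TopologicalSpace G] [ChartedSpace E G] [Group G]

/-- The Lie algebra `𝔨 ⊆ 𝔤` of a closed subgroup `K` of the Lie group `G`: the velocities at `e` of
the smooth curves through `e` that run in `K`. -/
def subgroupLieAlgebra [LieGroup 𝓘(ℝ, E) ∞ G] (K : Subgroup G) :
    Submodule ℝ (GroupLieAlgebra 𝓘(ℝ, E) G) where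
  carrier := {X | ∃ c : ℝ → G, ContMDiff 𝓘(ℝ, ℝ) 𝓘(ℝ, E) ∞ c ∧ c 0 = 1 ∧ (∀ t, c t ∈ K) ∧
    HasMFDerivAt 𝓘(ℝ, ℝ) 𝓘(ℝ, E) c 0
      (ContinuousLinearMap.toSpanSingleton ℝ (X : E) : ℝ →L[ℝ] E)}
  zero_mem' := by
    refine ⟨fun _ => 1, contMDiff_const, rfl, fun _ => K.one_mem, ?_⟩
    have h : (ContinuousLinearMap.toSpanSingleton ℝ (0 : E) : ℝ →L[ℝ] E) = 0 := by simp
    exact h ▸ hasMFDerivAt_const (I := 𝓘(ℝ, ℝ)) (I' := 𝓘(ℝ, E)) (1 : G) (0 : ℝ)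
  add_mem' := by
    rintro X Y ⟨c, hc, hc0, hcK, hcX⟩ ⟨d, hd, hd0, hdK, hdY⟩
    refine ⟨fun t => c t * d t, hc.mul hd, by simp [hc0, hd0],
      fun t => K.mul_mem (hcK t) (hdK t), ?_⟩
    have hmul : MDifferentiableAt (𝓘(ℝ, E).prod 𝓘(ℝ, E)) 𝓘(ℝ, E)
        (fun p : G × G => p.1 * p.2) ((1 : G), (1 : G)) :=
      (contMDiff_mul 𝓘(ℝ, E) ∞).mdifferentiableAt (by simp)
    have h1 : HasMFDerivAt (𝓘(ℝ, E).prod 𝓘(ℝ, E)) 𝓘(ℝ, E)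
        (fun p : G × G => p.1 * p.2) ((1 : G), (1 : G))
        (ContinuousLinearMap.fst ℝ E E + ContinuousLinearMap.snd ℝ E E) := by
      have h2 := hmul.hasMFDerivAt
      have h3 : mfderiv (𝓘(ℝ, E).prod 𝓘(ℝ, E)) 𝓘(ℝ, E) (fun p : G × G => p.1 * p.2)
          ((1 : G), (1 : G)) = (ContinuousLinearMap.fst ℝ E E + ContinuousLinearMap.snd ℝ E E :
            E × E →L[ℝ] E) := by
        refine ContinuousLinearMap.ext fun v => ?_
        have e1 : mfderiv 𝓘(ℝ, E) 𝓘(ℝ, E) (fun z : G => z * 1) 1 = ContinuousLinearMap.id ℝ E := by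
          have : (fun z : G => z * 1) = id := funext mul_one
          rw [this]; exact mfderiv_id
        have e2 : mfderiv 𝓘(ℝ, E) 𝓘(ℝ, E) (fun z : G => 1 * z) 1 = ContinuousLinearMap.id ℝ E := by
          have : (fun z : G => 1 * z) = id := funext one_mul
          rw [this]; exact mfderiv_id
        exact (mfderiv_prod_eq_add_apply hmul).trans
          (congrArg₂ (fun A B : E →L[ℝ] E => A (v : E × E).1 + B (v : E × E).2) e1 e2)
      exact h3 ▸ h2
    have h1' : HasMFDerivAt (𝓘(ℝ, E).prod 𝓘(ℝ, E)) 𝓘(ℝ, E)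
        (fun p : G × G => p.1 * p.2) (c 0, d 0)
        (ContinuousLinearMap.fst ℝ E E + ContinuousLinearMap.snd ℝ E E) := by
      rw [hc0, hd0]; exact h1
    have h4 := HasMFDerivAt.comp (I' := 𝓘(ℝ, E).prod 𝓘(ℝ, E)) (0 : ℝ) h1' (hcX.prodMk hdY)
    have h5 : (ContinuousLinearMap.toSpanSingleton ℝ ((X : E) + Y) : ℝ →L[ℝ] E)
        = (ContinuousLinearMap.fst ℝ E E + ContinuousLinearMap.snd ℝ E E).comp
            ((ContinuousLinearMap.toSpanSingleton ℝ (X : E)).prod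
              (ContinuousLinearMap.toSpanSingleton ℝ (Y : E))) :=
      ContinuousLinearMap.ext fun t => smul_add t (X : E) (Y : E)
    exact h5 ▸ h4
  smul_mem' := by
    rintro a X ⟨c, hc, hc0, hcK, hcX⟩
    refine ⟨fun t => c (a * t), hc.comp (contMDiff_iff_contDiff.2 (by fun_prop)), by simp [hc0],
      fun t => hcK _, ?_⟩
    have h1 : HasMFDerivAt 𝓘(ℝ, ℝ) 𝓘(ℝ, ℝ) (fun t : ℝ => a * t) 0
        (ContinuousLinearMap.toSpanSingleton ℝ a) := by
      have h2 := (hasDerivAt_id (0 : ℝ)).const_mul a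
      simp only [mul_one] at h2
      exact h2.hasFDerivAt.hasMFDerivAt
    have h0 : a * (0 : ℝ) = 0 := mul_zero a
    have h3 : HasMFDerivAt 𝓘(ℝ, ℝ) 𝓘(ℝ, E) c (a * 0)
      (ContinuousLinearMap.toSpanSingleton ℝ (X : E) : ℝ →L[ℝ] E) := by
      rw [h0]; exact hcX
    have h4 := HasMFDerivAt.comp (I' := 𝓘(ℝ, ℝ)) (0 : ℝ) h3 h1
    have h5 : (ContinuousLinearMap.toSpanSingleton ℝ (a • (X : E)) : ℝ →L[ℝ] E)
        = (ContinuousLinearMap.toSpanSingleton ℝ (X : E)).comp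
            (ContinuousLinearMap.toSpanSingleton ℝ a) :=
      ContinuousLinearMap.ext fun t => (smul_assoc t a (X : E)).symm
    exact h5 ▸ h4

/-- The reductive decomposition `𝔤 = 𝔨 ⊕ 𝔪` with `[𝔨, 𝔪] ⊆ 𝔪`. (A linear complement of `𝔨` is
always the orthogonal complement of `𝔨` for some inner product on `𝔤`.) -/
structure IsReductiveComplement [LieGroup 𝓘(ℝ, E) ∞ G] (K : Subgroup G)
    (m : Submodule ℝ (GroupLieAlgebra 𝓘(ℝ, E) G)) : Prop where
  isCompl : IsCompl (subgroupLieAlgebra K) m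
  bracket_mem : ∀ X ∈ subgroupLieAlgebra (E := E) K, ∀ Y ∈ m, ⁅X, Y⁆ ∈ m

variable {F : Type*} [NormedAddCommGroup F] [NormedSpace ℝ F]
  {K : Subgroup G} [ChartedSpace F (G ⧸ K)]

/-- A Riemannian metric on `G/K` is `G`-invariant if all translations `τ_a : pK ↦ apK` are
isometries. -/
def IsInvariantMetric [IsManifold 𝓘(ℝ, F) ∞ (G ⧸ K)] (g : Metric F (G ⧸ K)) : Prop :=
  ∀ (a : G) (x : G ⧸ K) (v w : TangentSpace 𝓘(ℝ, F) x),
    g.inner (a • x)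
      (mfderiv 𝓘(ℝ, F) 𝓘(ℝ, F) (fun y : G ⧸ K => a • y) x v)
      (mfderiv 𝓘(ℝ, F) 𝓘(ℝ, F) (fun y : G ⧸ K => a • y) x w) = g.inner x v w

/-- The vector `Ŵ_{π(a)} = dπ_a(W^L_a)`, where `W^L` is the left-invariant vector field of `W`. -/
def hatField (F : Type*) [NormedAddCommGroup F] [NormedSpace ℝ F] (K : Subgroup G)
    [ChartedSpace F (G ⧸ K)] (W : GroupLieAlgebra 𝓘(ℝ, E) G) (a : G) :
    TangentSpace 𝓘(ℝ, F) (QuotientGroup.mk a : G ⧸ K) :=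
  mfderiv 𝓘(ℝ, E) 𝓘(ℝ, F) (QuotientGroup.mk : G → G ⧸ K) a (mulInvariantVectorField W a)

/-- The function `G_W(t) = g(Ŵ_{γ(t)}, ∇_{γ'(t)} γ'(t))_{γ(t)}` of a curve `α` in `G`, with
`γ = π ∘ α`. -/
def functionG [IsManifold 𝓘(ℝ, F) ∞ (G ⧸ K)] (g : Metric F (G ⧸ K)) (J : Set ℝ) (α : ℝ → G)
    (W : GroupLieAlgebra 𝓘(ℝ, E) G) (t : ℝ) : ℝ :=
  g.inner (QuotientGroup.mk (α t) : G ⧸ K) (hatField F K W (α t))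
    (acceleration g J (fun s => (QuotientGroup.mk (α s) : G ⧸ K)) t)

end Homogeneous

end HomogeneousGeodesics

end

/-! The equivalence holds pointwise in `t`: the acceleration is a tangent vector at `γ(t)`, and by
positive definiteness of `g` it vanishes as soon as it is orthogonal to every vector of its tangent
space. So it suffices that the vectors `Ŵ`, `W ∈ m`, exhaust that space, which is
`exists_mem_hatField_eq`. Three facts give this: `dπ` is onto at every point; every tangent vector
of `G` at `a` extends to a left-invariant field; and `dπ` kills the fields coming from `𝔨`, so only
the `m`-component of such an extension contributes. -/

/-- The differential of a submersion between manifolds without boundary is surjective. -/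
theorem Manifold.IsSubmersion.surjective_mfderiv
    {E : Type*} [NormedAddCommGroup E] [NormedSpace ℝ E]
    {F : Type*} [NormedAddCommGroup F] [NormedSpace ℝ F]
    {M : Type*} [TopologicalSpace M] [ChartedSpace E M] [IsManifold 𝓘(ℝ, E) ∞ M]
    {N : Type*} [TopologicalSpace N] [ChartedSpace F N] [IsManifold 𝓘(ℝ, F) ∞ N]
    {f : M → N} (hf : Manifold.IsSubmersion 𝓘(ℝ, E) 𝓘(ℝ, F) ∞ f) (x : M) :
    Function.Surjective (mfderiv 𝓘(ℝ, E) 𝓘(ℝ, F) f x) := by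
  have h := hf.isSubmersionAt x
  set φ := h.domChart
  set ψ := h.codChart
  have hxφ : x ∈ φ.source := h.mem_domChart_source
  have hxψ : f x ∈ ψ.source := h.mem_codChart_source
  -- In the charts `f` is the projection to the first factor. Freezing the second coordinate at its
  -- value for `x` makes `φ.symm ∘ p` a local section of `f` through `x`, whose differential is a
  -- right inverse of that of `f`.
  set p : N → E := fun y => h.equiv.symm (ψ y, (h.equiv (φ x)).2) with hp
  have hw : ∀ u ∈ φ.target, ψ (f (φ.symm u)) = (h.equiv u).1 := fun u hu => by
    have hu' : u ∈ (h.domChart.extend 𝓘(ℝ, E)).target := by simpa using hu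
    have := h.writtenInCharts hu'
    simpa using this
  have hpx : p (f x) = φ x := by
    have := hw (φ x) (φ.map_source hxφ)
    rw [φ.left_inv hxφ] at this
    simp [hp, this]
  have hpd : MDifferentiableAt 𝓘(ℝ, F) 𝓘(ℝ, E) p (f x) := by
    have hψ : MDifferentiableAt 𝓘(ℝ, F) 𝓘(ℝ, F) ψ (f x) :=
      ((contMDiffOn_of_mem_maximalAtlas h.codChart_mem_maximalAtlas).contMDiffAt
        (ψ.open_source.mem_nhds hxψ)).mdifferentiableAt (by simp)
    have hq : DifferentiableAt ℝ (fun z : F => h.equiv.symm (z, (h.equiv (φ x)).2)) (ψ (f x)) := by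
      fun_prop
    exact MDifferentiableAt.comp (I' := 𝓘(ℝ, F))
      (g := fun z : F => h.equiv.symm (z, (h.equiv (φ x)).2)) (f x) hq.mdifferentiableAt hψ
  have hφd : MDifferentiableAt 𝓘(ℝ, E) 𝓘(ℝ, E) φ.symm (p (f x)) := by
    rw [hpx]
    exact ((contMDiffOn_symm_of_mem_maximalAtlas h.domChart_mem_maximalAtlas).contMDiffAt
      (φ.open_target.mem_nhds (φ.map_source hxφ))).mdifferentiableAt (by simp)
  have hσ : MDifferentiableAt 𝓘(ℝ, F) 𝓘(ℝ, E) (φ.symm ∘ p) (f x) :=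
    MDifferentiableAt.comp (I' := 𝓘(ℝ, E)) (f x) hφd hpd
  have hσx : (φ.symm ∘ p) (f x) = x := by
    simp only [Function.comp_apply, hpx, φ.left_inv hxφ]
  have hfd : MDifferentiableAt 𝓘(ℝ, E) 𝓘(ℝ, F) f ((φ.symm ∘ p) (f x)) := by
    rw [hσx]
    exact hf.contMDiff.contMDiffAt.mdifferentiableAt (by simp)
  have hid : f ∘ (φ.symm ∘ p) =ᶠ[𝓝 (f x)] id := by
    have h1 : ∀ᶠ y in 𝓝 (f x), p y ∈ φ.target :=
      hpd.continuousAt.preimage_mem_nhds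
        (φ.open_target.mem_nhds (by rw [hpx]; exact φ.map_source hxφ))
    filter_upwards [h1, ψ.open_source.mem_nhds hxψ] with y hy hyψ
    refine ψ.injOn (h.source_subset_preimage_source (φ.map_target hy)) hyψ ?_
    exact (hw _ hy).trans (by simp [hp])
  have hcomp := mfderiv_comp (I' := 𝓘(ℝ, E)) (f x) hfd hσ
  rw [hid.mfderiv_eq, mfderiv_id] at hcomp
  intro v
  have hv := congrArg (fun L : F →L[ℝ] F => L v) hcomp
  -- The chain rule gives the differential of `f` at `(φ.symm ∘ p) (f x)`, which equals `x` only
  -- propositionally; a free base point `z` permits the transport.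
  have key : ∀ z : M, z = x → (∃ w : E, (mfderiv 𝓘(ℝ, E) 𝓘(ℝ, F) f z : E →L[ℝ] F) w = v) →
      ∃ w : E, (mfderiv 𝓘(ℝ, E) 𝓘(ℝ, F) f x : E →L[ℝ] F) w = v := by
    rintro z rfl h; exact h
  exact key _ hσx ⟨_, hv.symm⟩

namespace HomogeneousGeodesics

section

variable {E : Type*} [NormedAddCommGroup E] [NormedSpace ℝ E]
  {G : Type*} [TopologicalSpace G] [ChartedSpace E G] [Group G] [LieGroup 𝓘(ℝ, E) ∞ G]

theorem mdifferentiableAt_mul_left (a b : G) :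
    MDifferentiableAt 𝓘(ℝ, E) 𝓘(ℝ, E) (fun x : G => a * x) b :=
  (contMDiff_mul_left (I := 𝓘(ℝ, E)) (n := ∞)).contMDiffAt.mdifferentiableAt (by simp)

/-- Every tangent vector at `a` is the value at `a` of a left-invariant vector field. -/
theorem exists_mulInvariantVectorField_eq (a : G) (v : TangentSpace 𝓘(ℝ, E) a) :
    ∃ W : GroupLieAlgebra 𝓘(ℝ, E) G, mulInvariantVectorField W a = v := by
  -- Differentiating this identity at `a` gives a right inverse of the differential of left
  -- translation by `a` at `a⁻¹ * a`, that is, at the identity.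
  have hid : (fun x : G => a * x) ∘ (fun x : G => a⁻¹ * x) = id := by ext; simp
  have hcomp := mfderiv_comp (I := 𝓘(ℝ, E)) (I' := 𝓘(ℝ, E)) (I'' := 𝓘(ℝ, E)) a
    (mdifferentiableAt_mul_left a (a⁻¹ * a)) (mdifferentiableAt_mul_left a⁻¹ a)
  rw [hid, mfderiv_id] at hcomp
  have hv := congrArg (fun L : E →L[ℝ] E => L v) hcomp
  have key : ∀ z : G, z = 1 →
      (∃ w : E, (mfderiv 𝓘(ℝ, E) 𝓘(ℝ, E) (fun x : G => a * x) z : E →L[ℝ] E) w = v) →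
      ∃ w : E, (mfderiv 𝓘(ℝ, E) 𝓘(ℝ, E) (fun x : G => a * x) 1 : E →L[ℝ] E) w = v := by
    rintro z rfl h; exact h
  exact key _ (inv_mul_cancel a) ⟨_, hv.symm⟩

variable {F : Type*} [NormedAddCommGroup F] [NormedSpace ℝ F]
  {K : Subgroup G} [ChartedSpace F (G ⧸ K)]

/-- Left-invariant fields of vectors in `𝔨` are tangent to the fibres of `G → G/K`. -/
theorem hatField_eq_zero (a : G)
    (hπ : MDifferentiableAt 𝓘(ℝ, E) 𝓘(ℝ, F) (QuotientGroup.mk : G → G ⧸ K) a)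
    {X : GroupLieAlgebra 𝓘(ℝ, E) G} (hX : X ∈ subgroupLieAlgebra (E := E) K) :
    hatField F K X a = 0 := by
  obtain ⟨c, -, hc0, hcK, hcX⟩ := hX
  have h1 : HasMFDerivAt 𝓘(ℝ, E) 𝓘(ℝ, E) (fun x : G => a * x) (c 0)
      (mfderiv 𝓘(ℝ, E) 𝓘(ℝ, E) (fun x : G => a * x) 1 : E →L[ℝ] E) := by
    rw [hc0]; exact (mdifferentiableAt_mul_left a 1).hasMFDerivAt
  have h2 : HasMFDerivAt 𝓘(ℝ, E) 𝓘(ℝ, F) (QuotientGroup.mk : G → G ⧸ K) (a * c 0)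
      (mfderiv 𝓘(ℝ, E) 𝓘(ℝ, F) (QuotientGroup.mk : G → G ⧸ K) a : E →L[ℝ] F) := by
    rw [hc0, mul_one]; exact hπ.hasMFDerivAt
  have h3 := HasMFDerivAt.comp (I' := 𝓘(ℝ, E)) (0 : ℝ) h2
    (HasMFDerivAt.comp (I' := 𝓘(ℝ, E)) (0 : ℝ) h1 hcX)
  -- Since `c` runs in `K`, the curve `a * c t` stays in the coset `aK`; its velocity at `0` is the
  -- left-invariant field of `X` at `a`, so the projection of that vector is the derivative of a
  -- constant.
  have hconst : (QuotientGroup.mk : G → G ⧸ K) ∘ ((fun x : G => a * x) ∘ c)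
      = fun _ => (QuotientGroup.mk (a * c 0) : G ⧸ K) := by
    funext t
    refine QuotientGroup.eq.2 ?_
    simpa [hc0] using hcK t
  rw [hconst] at h3
  have h4 := hasMFDerivAt_unique h3
    (hasMFDerivAt_const (I := 𝓘(ℝ, ℝ)) (I' := 𝓘(ℝ, F)) (QuotientGroup.mk (a * c 0) : G ⧸ K)
      (0 : ℝ))
  have h5 := congrArg (fun L : ℝ →L[ℝ] F => L 1) h4
  have h6 : (ContinuousLinearMap.toSpanSingleton ℝ (X : E) : ℝ →L[ℝ] E) 1 = (X : E) :=
    one_smul ℝ (X : E)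
  have h7 : (mfderiv 𝓘(ℝ, E) 𝓘(ℝ, F) (QuotientGroup.mk : G → G ⧸ K) a : E →L[ℝ] F)
      ((mfderiv 𝓘(ℝ, E) 𝓘(ℝ, E) (fun x : G => a * x) 1 : E →L[ℝ] E)
        ((ContinuousLinearMap.toSpanSingleton ℝ (X : E) : ℝ →L[ℝ] E) 1)) = 0 := h5
  rw [h6] at h7
  exact h7

omit [LieGroup 𝓘(ℝ, E) ∞ G] in
theorem hatField_add (X Y : GroupLieAlgebra 𝓘(ℝ, E) G) (a : G) :
    hatField F K (X + Y) a = hatField F K X a + hatField F K Y a := by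
  unfold hatField
  rw [mulInvariantVectorField_add, Pi.add_apply]
  exact map_add (mfderiv 𝓘(ℝ, E) 𝓘(ℝ, F) (QuotientGroup.mk : G → G ⧸ K) a) _ _

/-- The vectors `Ŵ`, for `W` in a linear complement of `𝔨`, fill the tangent space of `G/K`. -/
theorem exists_mem_hatField_eq [IsManifold 𝓘(ℝ, F) ∞ (G ⧸ K)]
    (hπ : Manifold.IsSubmersion 𝓘(ℝ, E) 𝓘(ℝ, F) ∞ (QuotientGroup.mk : G → G ⧸ K))
    {m : Submodule ℝ (GroupLieAlgebra 𝓘(ℝ, E) G)} (hm : IsCompl (subgroupLieAlgebra K) m)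
    (a : G) (v : TangentSpace 𝓘(ℝ, F) (QuotientGroup.mk a : G ⧸ K)) :
    ∃ W ∈ m, hatField F K W a = v := by
  have : IsManifold 𝓘(ℝ, E) ∞ G := ContMDiffMul.toIsManifold
  obtain ⟨u, hu⟩ := hπ.surjective_mfderiv a v
  obtain ⟨Z, hZ⟩ := exists_mulInvariantVectorField_eq a u
  obtain ⟨X, hX, W, hW, rfl⟩ : ∃ X ∈ subgroupLieAlgebra (E := E) K, ∃ W ∈ m, X + W = Z :=
    Submodule.mem_sup.1 (hm.sup_eq_top ▸ Submodule.mem_top)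
  refine ⟨W, hW, ?_⟩
  have h0 := hatField_eq_zero (F := F) a (hπ.contMDiff.contMDiffAt.mdifferentiableAt (by simp)) hX
  have h1 := hatField_add (F := F) (K := K) X W a
  rw [h0, zero_add] at h1
  rw [← h1, ← hu, ← hZ]
  rfl

end

end HomogeneousGeodesics

theorem proposition2p2
    {E : Type*} [NormedAddCommGroup E] [NormedSpace ℝ E] [FiniteDimensional ℝ E]
    {G : Type*} [TopologicalSpace G] [ChartedSpace E G] [Group G] [LieGroup 𝓘(ℝ, E) ∞ G]
    {F : Type*} [NormedAddCommGroup F] [NormedSpace ℝ F] [FiniteDimensional ℝ F]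
    (K : Subgroup G) [ChartedSpace F (G ⧸ K)] [IsManifold 𝓘(ℝ, F) ∞ (G ⧸ K)]
    (hπ : Manifold.IsSubmersion 𝓘(ℝ, E) 𝓘(ℝ, F) ∞ (QuotientGroup.mk : G → G ⧸ K))
    (m : Submodule ℝ (GroupLieAlgebra 𝓘(ℝ, E) G))
    (hm : HomogeneousGeodesics.IsReductiveComplement K m)
    (g : HomogeneousGeodesics.Metric F (G ⧸ K))
    (hg : HomogeneousGeodesics.IsInvariantMetric g)
    (J : Set ℝ) (hJ : J.OrdConnected) (hJ' : J.Nontrivial)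
    (α : ℝ → G) (hα : ContMDiffOn 𝓘(ℝ, ℝ) 𝓘(ℝ, E) ∞ α J) :
    HomogeneousGeodesics.IsGeodesicOn g J (fun t => (QuotientGroup.mk (α t) : G ⧸ K)) ↔
      ∀ t ∈ J, ∀ W ∈ m, HomogeneousGeodesics.functionG g J α W t = 0 := by
  constructor
  · rintro ⟨-, h⟩ t ht W -
    unfold HomogeneousGeodesics.functionG
    rw [h t ht]
    exact map_zero _
  · intro h
    refine ⟨hπ.contMDiff.comp_contMDiffOn hα, fun t ht => ?_⟩
    -- `W` may depend on `t`: it is chosen so that `Ŵ` is the acceleration at this instant, and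
    -- `G_W(t)` becomes its squared length.
    obtain ⟨W, hW, hWt⟩ := HomogeneousGeodesics.exists_mem_hatField_eq hπ hm.isCompl (α t)
      (HomogeneousGeodesics.acceleration g J (fun s => (QuotientGroup.mk (α s) : G ⧸ K)) t)
    have h0 := h t ht W hW
    unfold HomogeneousGeodesics.functionG at h0
    rw [hWt] at h0
    by_contra hne
    exact (g.pos _ _ hne).ne' h0
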